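/- Let $\mathbb{K}$ be $\mathbb{R}$ or $\mathbb{C}$, let $A$ be a finite-dimensional associative, not necessarily unital, $\mathbb{K}$-algebra, let $\mathrm{Nil}(A)$ be its nilradical (the sum of all its nilpotent two-sided ideals), and let $S\subseteq A$ be a semisimple subalgebra (that is, $\mathrm{Nil}(S)=0$; the case $S=0$ is allowed) such that $A=S\dotplus \mathrm{Nil}(A)$ as a direct sum of vector spaces. Put $$Q=\{a^2: a\in S\}\cup\{a^2: a\in \mathrm{Nil}(A)\},$$ and for $x\in A$ let $E_x$ be the set of all idempotents $e\in A$ with $$\{a\in A: xax=0\}\cap Q=eAe\cap Q .$$ Suppose that $A=S\dotplus\mathrm{Nil}(A)$ is an almost inner Rickart algebra, i.e. $E_x\neq\emptyset$ for every $x\in A$, and that it satisfies Condition (B), i.e. $E_x\subseteq S$ for every $x\in A$. Then there exist $m\ge 0$ and pairwise orthogonal idempotents $e_1,\dots,e_m$ in $A$ such that $$S=e_1F_1\oplus\dots\oplus e_mF_m,\qquad A=(e_1F_1\oplus\dots\oplus e_mF_m)\dotplus \mathrm{Nil}(A),$$ where each $F_i$ is one of $\mathbb{R},\mathbb{C},\mathbb{H}$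 if $\mathbb{K}=\mathbb{R}$ (possibly different ones for different $i$), and $F_i=\mathbb{C}$ for all $i$ if $\mathbb{K}=\mathbb{C}$; here $e_iF_i$ denotes a $\mathbb{K}$-subalgebra of $A$ with identity element $e_i$ that is isomorphic to $F_i$ as a $\mathbb{K}$-algebra. In particular, no subring of $S$ is isomorphic to a matrix ring $M_k(D)$ with $k\ge 2$ and $D$ a division ring. -/

import Mathlib

universe u v

namespace AlmostRickart

section Defs

variable (𝕜 : Type*) [Field 𝕜] {A : Type*} [NonUnitalRing A] [Module 𝕜 A]

/-- A (two-sided) ideal of an associative, not necessarily unital, algebra: a linear subspace that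
is stable under left and right multiplication by arbitrary elements. -/
def IsAlgIdeal (I : Submodule 𝕜 A) : Prop :=
  ∀ a : A, ∀ x ∈ I, a * x ∈ I ∧ x * a ∈ I

/-- `powSucc 𝕜 I n` is the power `I ^ (n + 1)`, the span of all products of `n + 1` elements
of `I`. -/
def powSucc (I : Submodule 𝕜 A) : ℕ → Submodule 𝕜 A
  | 0 => I
  | n + 1 => Submodule.span 𝕜 (Set.image2 (fun x y => x * y) (I : Set A) (powSucc I n : Set A))

/-- The subspace `I` is nilpotent: some positive power of it vanishes. -/
def IsNilpotentSubspace (I : Submodule 𝕜 A) : Prop :=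
  ∃ n : ℕ, powSucc 𝕜 I n = ⊥

variable (A) in
/-- The nilradical `Nil(A)`: the sum of all nilpotent two-sided ideals of `A`. For a
finite-dimensional algebra it is the largest nilpotent two-sided ideal. -/
def nil : Submodule 𝕜 A :=
  sSup {I : Submodule 𝕜 A | IsAlgIdeal 𝕜 I ∧ IsNilpotentSubspace 𝕜 I}

variable (A) in
/-- A finite-dimensional algebra is semisimple if its nilradical vanishes (the zero algebra is
semisimple). -/
def IsSemisimpleAlg : Prop :=
  nil 𝕜 A = ⊥

/-- The quadratic annihilator `{a ∈ A : s a s = 0 for all s ∈ B}` of a set `B`. -/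
def quadAnn (B : Set A) : Set A :=
  {a : A | ∀ s ∈ B, s * a * s = 0}

/-- The set `e A e`. -/
def corner (e : A) : Set A :=
  {b : A | ∃ a : A, b = e * a * e}

/-- The set `{a ^ 2 : a ∈ B}` of squares of elements of `B`. -/
def squares (B : Set A) : Set A :=
  {b : A | ∃ a ∈ B, b = a * a}

variable {𝕜}

/-- The set `S² ∪ N²`, where `N` is the nilradical of `A`. -/
def squaresUnion (S : NonUnitalSubalgebra 𝕜 A) : Set A :=
  squares (S : Set A) ∪ squares (nil 𝕜 A : Set A)

/-- `e` is an idempotent of `A` with `⊥q{x} ∩ (S² ∪ N²) = e A e ∩ (S² ∪ N²)`. -/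
def IsRickartIdempotent (S : NonUnitalSubalgebra 𝕜 A) (x e : A) : Prop :=
  IsIdempotentElem e ∧
    quadAnn {x} ∩ squaresUnion S = corner e ∩ squaresUnion S

/-- `A`, decomposed as `A = S ∔ Nil(A)` with a semisimple subalgebra `S`, is an almost inner
Rickart algebra. -/
structure IsAlmostInnerRickart (S : NonUnitalSubalgebra 𝕜 A) : Prop where
  /-- the subalgebra `S` is semisimple -/
  semisimple : IsSemisimpleAlg 𝕜 S
  /-- `A` is the direct sum of the vector spaces `S` and `Nil(A)` -/
  isCompl : IsCompl S.toSubmodule (nil 𝕜 A)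
  /-- the almost inner Rickart condition -/
  exists_idempotent : ∀ x : A, ∃ e : A, IsRickartIdempotent S x e

/-- Condition (B): every idempotent that occurs in the almost inner Rickart condition, for
whatever `x`, lies in `S`. -/
def ConditionB (S : NonUnitalSubalgebra 𝕜 A) : Prop :=
  ∀ x e : A, IsRickartIdempotent S x e → e ∈ S

/-- `D = e F`: the subalgebra `D` of `A` is a copy of the unital algebra `F` whose identity
element is `e`. -/
def IsCopyOf (F : Type*) [Ring F] [Algebra 𝕜 F] (e : A) (D : NonUnitalSubalgebra 𝕜 A) : Prop :=
  ∃ φ : F →ₙₐ[𝕜] A, Function.Injective φ ∧ φ 1 = e ∧ NonUnitalAlgHom.range φ = D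

/-- `S = D₁ ⊕ ⋯ ⊕ Dₘ` and `A = (D₁ ⊕ ⋯ ⊕ Dₘ) ∔ Nil(A)`, where `e₁, …, eₘ` are pairwise orthogonal
idempotents. -/
structure IsDecomposition (S : NonUnitalSubalgebra 𝕜 A) {m : ℕ} (e : Fin m → A)
    (D : Fin m → NonUnitalSubalgebra 𝕜 A) : Prop where
  idempotent : ∀ i, IsIdempotentElem (e i)
  orthogonal : ∀ i j, i ≠ j → e i * e j = 0
  independent : iSupIndep fun i => (D i).toSubmodule
  iSup_eq : ⨆ i, (D i).toSubmodule = S.toSubmodule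
  isCompl : IsCompl (⨆ i, (D i).toSubmodule) (nil 𝕜 A)

/-- No subring of `S` is isomorphic to a full matrix ring `M_k(D)` with `k ≥ 2` over a division
ring `D`. -/
def NoMatrixBlocks (S : NonUnitalSubalgebra 𝕜 A) : Prop :=
  ∀ k : ℕ, 2 ≤ k → ∀ (D : Type v) [DivisionRing D],
    ¬ ∃ φ : Matrix (Fin k) (Fin k) D →ₙ+* S, Function.Injective φ

end Defs

end AlmostRickart

namespace AlmostRickart

/-! ### The unit of `S` and the absence of nilpotents in `S`. -/

section Reduced

variable {𝕜 : Type*} [Field 𝕜] {A : Type*} [NonUnitalRing A] [Module 𝕜 A]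

/-! The Rickart condition, tested on squares of elements of `S`, forces `S` to be unital and
reduced. For `x = 0` every square of `S` lies in some `eAe` with `e ∈ S`; polarising makes `e`
central in `S`, and semisimplicity makes it the unit (`exists_unit`). If `x ∈ S` and `x² = 0`, the
idempotent attached to `x` must be this unit, so `x s² x = 0` for all `s ∈ S`; polarising gives `x S
x = 0`, hence `x = 0` (`eq_zero_of_mul_self_eq_zero`).

By Wedderburn–Artin, a finite-dimensional reduced unital algebra is a product of division algebras.
Over `ℝ` these are listed by `frobenius_real`; over `ℂ` only `ℂ` occurs. Matrix rings of size at
least 2 contain nonzero elements of square zero, so none embeds in `S`. -/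

theorem eq_bot_of_isSemisimpleAlg (h : IsSemisimpleAlg 𝕜 A) {I : Submodule 𝕜 A}
    (hI : IsAlgIdeal 𝕜 I) (hn : IsNilpotentSubspace 𝕜 I) : I = ⊥ :=
  le_bot_iff.1 ((le_sSup ⟨hI, hn⟩ : I ≤ nil 𝕜 A).trans_eq h)

theorem eq_zero_of_self_eq_neg [CharZero 𝕜] {x : A} (h : x = -x) : x = 0 := by
  have h2 : (2 : 𝕜) • x = 0 := by
    rw [two_smul]
    exact add_eq_zero_iff_eq_neg.2 h
  exact (smul_eq_zero.1 h2).resolve_left two_ne_zero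

variable [IsScalarTower 𝕜 A A] [SMulCommClass 𝕜 A A]

omit [IsScalarTower 𝕜 A A] in
/-- An ideal in which all squares vanish is nilpotent. -/
theorem isNilpotentSubspace_of_mul_self_eq_zero [CharZero 𝕜] {I : Submodule 𝕜 A}
    (hI : IsAlgIdeal 𝕜 I) (h : ∀ x ∈ I, x * x = 0) : IsNilpotentSubspace 𝕜 I := by
  have anti : ∀ a ∈ I, ∀ b ∈ I, a * b = -(b * a) := fun a ha b hb => by
    have := h (a + b) (I.add_mem ha hb)
    simp only [mul_add, add_mul, h a ha, h b hb, zero_add, add_zero] at this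
    exact eq_neg_of_add_eq_zero_right this
  -- Each cyclic rotation of the product costs a sign, and three rotations restore it.
  have triple : ∀ a ∈ I, ∀ b ∈ I, ∀ c ∈ I, a * (b * c) = 0 := fun a ha b hb c hc => by
    refine eq_zero_of_self_eq_neg (𝕜 := 𝕜) ?_
    calc a * (b * c) = -(b * c * a) := anti a ha _ (hI b c hc).1
      _ = c * a * b := by rw [mul_assoc, anti b hb _ (hI c a ha).1, neg_neg]
      _ = -(a * b * c) := by rw [mul_assoc, anti c hc _ (hI a b hb).1]
      _ = -(a * (b * c)) := by rw [mul_assoc]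
  -- Index 2 of `powSucc` is the cube of `I`.
  refine ⟨2, ?_⟩
  simp only [powSucc, Submodule.span_eq_bot, Set.mem_image2]
  rintro _ ⟨a, ha, y, hy, rfl⟩
  have : powSucc 𝕜 I 1 ≤ LinearMap.ker (LinearMap.mulLeft 𝕜 a) := by
    refine Submodule.span_le.2 ?_
    rintro _ ⟨b, hb, c, hc, rfl⟩
    exact triple a ha b hb c hc
  exact this hy

/-- In a unital semisimple algebra, `x A x = 0` forces `x = 0`. -/
theorem eq_zero_of_sandwich_eq_zero (h : IsSemisimpleAlg 𝕜 A) {u : A}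
    (hu : ∀ a : A, u * a = a ∧ a * u = a) {x : A} (hx : ∀ a, x * a * x = 0) : x = 0 := by
  let I : Submodule 𝕜 A := Submodule.span 𝕜 (Set.range fun p : A × A => p.1 * x * p.2)
  have hI : IsAlgIdeal 𝕜 I := by
    intro a y hy
    constructor
    · have : I ≤ I.comap (LinearMap.mulLeft 𝕜 a) := by
        refine Submodule.span_le.2 ?_
        rintro _ ⟨⟨b, c⟩, rfl⟩
        exact Submodule.subset_span ⟨(a * b, c), by simp [mul_assoc]⟩
      exact this hy
    · have : I ≤ I.comap (LinearMap.mulRight 𝕜 a) := by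
        refine Submodule.span_le.2 ?_
        rintro _ ⟨⟨b, c⟩, rfl⟩
        exact Submodule.subset_span ⟨(b, c * a), by simp [mul_assoc]⟩
      exact this hy
  have hn : IsNilpotentSubspace 𝕜 I := by
    refine ⟨1, ?_⟩
    simp only [powSucc, Submodule.span_eq_bot, Set.mem_image2]
    rintro _ ⟨y, hy, z, hz, rfl⟩
    refine Submodule.span_induction₂ (p := fun y z _ _ => y * z = 0) ?_ (by simp) (by simp)
      ?_ ?_ ?_ ?_ hy hz
    · rintro _ _ ⟨⟨a, b⟩, rfl⟩ ⟨⟨c, d⟩, rfl⟩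
      have := congrArg (fun t => a * t * d) (hx (b * c))
      simpa [mul_assoc] using this
    · intro x y z _ _ _ h1 h2; rw [add_mul, h1, h2, add_zero]
    · intro x y z _ _ _ h1 h2; rw [mul_add, h1, h2, add_zero]
    · intro r x y _ _ h1; rw [smul_mul_assoc, h1, smul_zero]
    · intro r x y _ _ h1; rw [mul_smul_comm, h1, smul_zero]
  have hmem : x ∈ I := Submodule.subset_span ⟨(u, u), by simp [hu]⟩
  rw [eq_bot_of_isSemisimpleAlg h hI hn] at hmem
  exact hmem

variable {S : NonUnitalSubalgebra 𝕜 A}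

omit [IsScalarTower 𝕜 A A] in
/-- The subalgebra `S` has an identity element. -/
theorem exists_unit [CharZero 𝕜] (hR : IsAlmostInnerRickart S) (hB : ConditionB S) :
    ∃ u : S, ∀ s : S, u * s = s ∧ s * u = s := by
  -- For `x = 0` the quadratic annihilator is all of `A`, so `eAe` contains every square of `S`.
  obtain ⟨e, he⟩ := hR.exists_idempotent 0
  obtain ⟨e, rfl⟩ : ∃ e' : S, (e' : A) = e := ⟨⟨e, hB _ _ he⟩, rfl⟩
  have hee : e * e = e := Subtype.ext he.1
  have hsq : ∀ s : S, e * (s * s) = s * s ∧ (s * s) * e = s * s := by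
    intro s
    have hm : (s : A) * s ∈ quadAnn {(0 : A)} ∩ squaresUnion S :=
      ⟨by simp [quadAnn], Or.inl ⟨s, s.2, rfl⟩⟩
    rw [he.2] at hm
    obtain ⟨⟨a, ha⟩, -⟩ := hm
    have he1 : (e : A) * e = e := he.1
    constructor <;> apply Subtype.ext
    · simp only [MulMemClass.coe_mul, ha]
      rw [← mul_assoc, ← mul_assoc, he1]
    · simp only [MulMemClass.coe_mul, ha]
      rw [mul_assoc, he1]
  -- Linearising at `s + e` gives `ese = se` and `ese = es`.
  have hcomm : ∀ s : S, e * s = s * e := by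
    intro s
    have h1 := hsq (s + e)
    have h2 := hsq s
    rw [← mul_assoc] at h2
    simp only [mul_add, add_mul, h2.1, h2.2, hee, ← mul_assoc] at h1
    have h3 := h1.1
    have h4 := h1.2
    rw [mul_assoc s e e, hee] at h4
    have h5 : e * s * e = s * e := by simpa using h3
    have h6 : e * s * e = e * s := by simpa using h4
    rw [← h5, h6]
  -- Centrality of `e` makes this an ideal of `S`, and `x² = e x² = 0` on it. It contains every `es
  -- - s`.
  let I : Submodule 𝕜 S := LinearMap.ker (LinearMap.mulLeft 𝕜 e)
  have mem_I : ∀ s : S, s ∈ I ↔ e * s = 0 := fun s => by simp [I]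
  have hI : IsAlgIdeal 𝕜 I := by
    intro a x hx
    rw [mem_I] at hx
    rw [mem_I, mem_I]
    constructor
    · rw [← mul_assoc, hcomm, mul_assoc, hx, mul_zero]
    · rw [← mul_assoc, hx, zero_mul]
  have hbot : I = ⊥ := by
    refine eq_bot_of_isSemisimpleAlg hR.semisimple hI
      (isNilpotentSubspace_of_mul_self_eq_zero hI fun x hx => ?_)
    rw [← (hsq x).1, ← mul_assoc, (mem_I x).1 hx, zero_mul]
  have hes : ∀ s : S, e * s = s := by
    intro s
    have : e * s - s ∈ I := by rw [mem_I, mul_sub, ← mul_assoc, hee, sub_self]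
    rw [hbot] at this
    exact sub_eq_zero.1 this
  exact ⟨e, fun s => ⟨hes s, by rw [← hcomm, hes]⟩⟩

/-- The subalgebra `S` has no nonzero nilpotent elements. -/
theorem eq_zero_of_mul_self_eq_zero [CharZero 𝕜] (hR : IsAlmostInnerRickart S)
    (hB : ConditionB S) {x : S} (hx : x * x = 0) : x = 0 := by
  obtain ⟨u, hu⟩ := exists_unit hR hB
  refine eq_zero_of_sandwich_eq_zero hR.semisimple hu ?_
  obtain ⟨e, he⟩ := hR.exists_idempotent x
  obtain ⟨e, rfl⟩ : ∃ e' : S, (e' : A) = e := ⟨⟨e, hB _ _ he⟩, rfl⟩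
  have huA : (u : A) * u = u := congrArg Subtype.val (hu u).1
  have hxu : (x : A) * u = x := congrArg Subtype.val (hu x).2
  have hxx : (x : A) * x = 0 := congrArg Subtype.val hx
  -- Since `xux = x² = 0`, the square `u = u²` lies in `eAe`, which forces `e = u`.
  have hum : (u : A) ∈ quadAnn {(x : A)} ∩ squaresUnion S :=
    ⟨by simp [quadAnn, hxu, hxx], Or.inl ⟨u, u.2, huA.symm⟩⟩
  rw [he.2] at hum
  obtain ⟨⟨a, ha⟩, -⟩ := hum
  have heu : e = u := by
    rw [← (hu e).2]
    apply Subtype.ext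
    have he1 : (e : A) * e = e := he.1
    simp only [MulMemClass.coe_mul, ha]
    rw [← mul_assoc, ← mul_assoc, he1]
  have hsq : ∀ s : S, x * (s * s) * x = 0 := by
    intro s
    have hm : (s : A) * s ∈ corner (e : A) ∩ squaresUnion S := by
      refine ⟨⟨s * s, ?_⟩, Or.inl ⟨s, s.2, rfl⟩⟩
      rw [heu]
      exact (congrArg Subtype.val (by rw [(hu (s * s)).1, (hu (s * s)).2] :
        u * (s * s) * u = s * s)).symm
    rw [← he.2] at hm
    exact Subtype.ext (hm.1 _ rfl)
  intro s
  -- As `x s² x` and `xux` vanish, what remains is `2 xsx = 0`.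
  have h := hsq (s + u)
  simp only [add_mul, mul_add, (hu _).1, (hu _).2, hsq s, hx, zero_add, add_zero] at h
  exact eq_zero_of_self_eq_neg (𝕜 := 𝕜) (eq_neg_of_add_eq_zero_left h)

omit [IsScalarTower 𝕜 A A] [SMulCommClass 𝕜 A A] in
theorem noMatrixBlocks_of_reduced (h : ∀ x : S, x * x = 0 → x = 0) : NoMatrixBlocks.{v} S := by
  rintro k hk D _ ⟨φ, hφ⟩
  let i : Fin k := ⟨0, by omega⟩
  let j : Fin k := ⟨1, by omega⟩
  have hij : j ≠ i := by simp [i, j]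
  have h0 : φ (Matrix.single i j 1) = 0 := by
    apply h
    rw [← map_mul, Matrix.single_mul_single_of_ne _ _ _ _ hij, map_zero]
  have h1 : Matrix.single i j (1 : D) = 0 := hφ (h0.trans (map_zero φ).symm)
  have := congrFun (congrFun h1 i) j
  simp at this

end Reduced

/-! ### Finite-dimensional real division algebras. -/

section Frobenius

variable {D : Type*} [DivisionRing D] [Algebra ℝ D] [FiniteDimensional ℝ D]

omit [FiniteDimensional ℝ D] in
theorem eq_smul_one_of_mul_self_eq {z : D} {d : ℝ} (hd : 0 ≤ d) (h : z * z = d • (1 : D)) :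
    ∃ r : ℝ, z = r • (1 : D) := by
  have h0 : (z - Real.sqrt d • (1 : D)) * (z + Real.sqrt d • (1 : D)) = 0 := by
    simp only [mul_add, sub_mul, smul_mul_assoc, mul_smul_comm, mul_one, one_mul, h]
    match_scalars
    · linear_combination -Real.sq_sqrt hd
    · ring
  rcases mul_eq_zero.1 h0 with h0 | h0
  · exact ⟨_, sub_eq_zero.1 h0⟩
  · exact ⟨-Real.sqrt d, by rw [eq_neg_of_add_eq_zero_left h0, neg_smul]⟩

omit [FiniteDimensional ℝ D] in
theorem smul_mul_self_eq_neg_one {z : D} {d : ℝ} (hd : d < 0) (h : z * z = d • (1 : D)) :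
    ((Real.sqrt (-d))⁻¹ • z) * ((Real.sqrt (-d))⁻¹ • z) = -1 := by
  have hs : Real.sqrt (-d) * Real.sqrt (-d) = -d := Real.mul_self_sqrt (by linarith)
  rw [smul_mul_smul_comm, h, smul_smul, ← mul_inv, hs, inv_neg, neg_mul, inv_mul_cancel₀ hd.ne,
    neg_one_smul]

/-- Every element of `D` is real or a real affine function of a square root of `-1`. -/
theorem exists_eq_smul_one_or_exists_mul_self_eq_neg_one (x : D) :
    (∃ a : ℝ, x = a • (1 : D)) ∨ ∃ (a c : ℝ) (y : D), y * y = -1 ∧ x = a • (1 : D) + c • y := by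
  have hint : IsIntegral ℝ x := Algebra.IsIntegral.isIntegral x
  have hp0 := minpoly.ne_zero hint
  obtain ⟨a, b, c, hp⟩ : ∃ a b c : ℝ, minpoly ℝ x =
      Polynomial.C a * Polynomial.X ^ 2 + Polynomial.C b * Polynomial.X + Polynomial.C c :=
    ⟨_, _, _, Polynomial.eq_quadratic_of_degree_le_two (minpoly.irreducible hint).degree_le_two⟩
  have hx : a • (x * x) + b • x + c • (1 : D) = 0 := by
    have := minpoly.aeval ℝ x
    rw [hp] at this
    simpa [Algebra.smul_def, sq] using this
  rcases eq_or_ne a 0 with rfl | ha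
  · rcases eq_or_ne b 0 with rfl | hb
    · have hc : c = 0 := by simpa using hx
      exact absurd (by simpa [hc] using hp) hp0
    · left
      refine ⟨-(c / b), ?_⟩
      have h : x = b⁻¹ • ((0 : ℝ) • (x * x) + b • x + c • (1 : D)) - (c / b) • (1 : D) := by
        match_scalars <;> field_simp <;> ring
      rw [h, hx]
      module
  · have hxx : x * x = (-(b / a)) • x + (-(c / a)) • (1 : D) := by
      have h : x * x = a⁻¹ • (a • (x * x) + b • x + c • (1 : D)) +
          ((-(b / a)) • x + (-(c / a)) • (1 : D)) := by
        match_scalars <;> field_simp <;> ring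
      rw [hx, smul_zero, zero_add] at h
      exact h
    -- Completing the square; the sign of `d` below separates real elements from multiples of a root
    -- of `-1`.
    set z : D := x + (b / (2 * a)) • (1 : D) with hz
    have hxz : x = (-(b / (2 * a))) • (1 : D) + z := by rw [hz]; module
    have hzz : z * z = ((b / (2 * a)) ^ 2 - c / a) • (1 : D) := by
      simp only [hz, mul_add, add_mul, smul_mul_assoc, mul_smul_comm, mul_one, one_mul, hxx]
      match_scalars <;> field_simp <;> ring
    generalize (b / (2 * a)) ^ 2 - c / a = d at hzz
    rcases le_or_gt 0 d with hd | hd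
    · left
      obtain ⟨r, hr⟩ := eq_smul_one_of_mul_self_eq hd hzz
      exact ⟨_, by rw [hxz, hr, ← add_smul]⟩
    · right
      have hs0 : Real.sqrt (-d) ≠ 0 := (Real.sqrt_pos.2 (by linarith)).ne'
      refine ⟨-(b / (2 * a)), Real.sqrt (-d), (Real.sqrt (-d))⁻¹ • z,
        smul_mul_self_eq_neg_one hd hzz, ?_⟩
      rw [smul_smul, mul_inv_cancel₀ hs0, one_smul, hxz]

/-- An element commuting with a square root `i` of `-1` lies in `ℝ + ℝ i`. -/
theorem exists_eq_of_commute {i x : D} (hi : i * i = -1) (h : i * x = x * i) :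
    ∃ a b : ℝ, x = a • (1 : D) + b • i := by
  rcases exists_eq_smul_one_or_exists_mul_self_eq_neg_one x with ⟨a, rfl⟩ | ⟨a, c, y, hy, rfl⟩
  · exact ⟨a, 0, by simp⟩
  rcases eq_or_ne c 0 with rfl | hc
  · exact ⟨a, 0, by simp⟩
  have hiy : i * y = y * i := by
    simp only [mul_add, add_mul, smul_mul_assoc, mul_smul_comm, mul_one, one_mul,
      add_right_inj] at h
    exact smul_right_injective D hc h
  have h0 : (y - i) * (y + i) = 0 := by
    rw [sub_mul, mul_add, mul_add, hy, hi, hiy]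
    abel
  rcases mul_eq_zero.1 h0 with h0 | h0
  · exact ⟨a, c, by rw [sub_eq_zero.1 h0]⟩
  · exact ⟨a, -c, by rw [eq_neg_of_add_eq_zero_left h0, smul_neg, neg_smul]⟩

/-- If `j ≠ 0` anticommutes with a square root `i` of `-1`, then some real multiple of `j` is a
square root of `-1`. -/
theorem exists_smul_mul_self_eq_neg_one {i j : D} (hi : i * i = -1) (hij : i * j = -(j * i))
    (hj : j ≠ 0) : ∃ r : ℝ, (r • j) * (r • j) = -1 := by
  have hi0 : i ≠ 0 := by rintro rfl; simp at hi
  have hcomm : i * (j * j) = j * j * i := by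
    rw [← mul_assoc, hij, neg_mul, mul_assoc, hij, mul_neg, neg_neg, mul_assoc]
  obtain ⟨a, b, hjj⟩ := exists_eq_of_commute hi hcomm
  -- `j` commutes with `j² = a + bi` but anticommutes with `i`.
  have hb : b • (i * j) = 0 := by
    have h1 : j * j * j = j * (j * j) := mul_assoc _ _ _
    rw [hjj] at h1
    simp only [mul_add, add_mul, smul_mul_assoc, mul_smul_comm, mul_one, one_mul,
      add_right_inj] at h1
    refine eq_zero_of_self_eq_neg (𝕜 := ℝ) ?_
    conv_lhs => rw [h1]
    rw [hij, smul_neg, neg_neg]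
  have hb0 : b = 0 := (smul_eq_zero.1 hb).resolve_right (mul_ne_zero hi0 hj)
  rw [hb0, zero_smul, add_zero] at hjj
  rcases le_or_gt 0 a with ha | ha
  -- Here `j` would be real, so it would both commute and anticommute with `i`.
  · obtain ⟨r, rfl⟩ := eq_smul_one_of_mul_self_eq ha hjj
    simp only [smul_mul_assoc, mul_smul_comm, mul_one, one_mul] at hij
    have := eq_zero_of_self_eq_neg (𝕜 := ℝ) hij
    rw [smul_eq_zero, or_iff_left hi0] at this
    simp [this] at hj
  · exact ⟨_, smul_mul_self_eq_neg_one ha hjj⟩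

/-- **Frobenius theorem** on finite-dimensional real division algebras. -/
theorem frobenius_real (D : Type*) [DivisionRing D] [Algebra ℝ D] [FiniteDimensional ℝ D] :
    Nonempty (ℝ ≃ₐ[ℝ] D) ∨ Nonempty (ℂ ≃ₐ[ℝ] D) ∨ Nonempty (Quaternion ℝ ≃ₐ[ℝ] D) := by
  by_cases h1 : ∃ i : D, i * i = -1
  swap
  · left
    refine ⟨AlgEquiv.ofBijective (Algebra.ofId ℝ D) ⟨(Algebra.ofId ℝ D).toRingHom.injective,
      fun x => ?_⟩⟩
    rcases exists_eq_smul_one_or_exists_mul_self_eq_neg_one x with ⟨a, rfl⟩ | ⟨a, c, y, hy, rfl⟩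
    · exact ⟨a, by rw [Algebra.ofId_apply, Algebra.algebraMap_eq_smul_one]⟩
    · exact absurd ⟨y, hy⟩ h1
  obtain ⟨i, hi⟩ := h1
  right
  by_cases h2 : ∃ j : D, j ≠ 0 ∧ i * j = -(j * i)
  · right
    obtain ⟨j, hj0, hj⟩ := h2
    obtain ⟨r, hr⟩ := exists_smul_mul_self_eq_neg_one hi hj hj0
    replace hj : i * (r • j) = -(r • j * i) := by
      rw [mul_smul_comm, hj, smul_mul_assoc, smul_neg]
    generalize r • j = j at hr hj
    let q : QuaternionAlgebra.Basis D (-1 : ℝ) 0 (-1) :=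
      { i := i, j := j, k := i * j
        i_mul_i := by rw [hi]; module
        j_mul_j := by rw [hr]; module
        i_mul_j := rfl
        j_mul_i := by rw [hj]; module }
    let φ : Quaternion ℝ →ₐ[ℝ] D := q.liftHom
    refine ⟨AlgEquiv.ofBijective φ ⟨φ.toRingHom.injective, fun x => ?_⟩⟩
    -- `x - ixi` commutes with `i`, while `x + ixi` anticommutes with it and so commutes after
    -- multiplication by `j`. Their half-sum is `x`.
    obtain ⟨a, b, hab⟩ := exists_eq_of_commute (x := x - i * x * i) hi (by
      simp only [mul_sub, sub_mul, ← mul_assoc, hi]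
      simp only [mul_assoc, hi]
      simp [add_comm])
    obtain ⟨c, d, hcd⟩ := exists_eq_of_commute (x := (x + i * x * i) * j) hi (by
      simp only [mul_add, add_mul, ← mul_assoc, hi]
      simp only [mul_assoc, ← neg_eq_iff_eq_neg.2 hj]
      simp only [mul_neg, ← mul_assoc, hi]
      simp [mul_assoc, add_comm])
    have hcd' : x + i * x * i = -(c • j + d • (i * j)) := by
      have h : (x + i * x * i) * (j * j) = (c • (1 : D) + d • i) * j := by rw [← mul_assoc, hcd]
      rw [hr, mul_neg, mul_one, add_mul, smul_mul_assoc, smul_mul_assoc, one_mul] at h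
      rw [← h, neg_neg]
    have hx : x = (1 / 2 : ℝ) • ((x - i * x * i) + (x + i * x * i)) := by module
    refine ⟨⟨a / 2, b / 2, -c / 2, -d / 2⟩, ?_⟩
    rw [hx, hab, hcd']
    change algebraMap ℝ D (a / 2) + (b / 2) • i + (-c / 2) • j + (-d / 2) • (i * j) = _
    rw [Algebra.algebraMap_eq_smul_one]
    module
  · left
    let φ : ℂ →ₐ[ℝ] D := Complex.lift ⟨i, hi⟩
    refine ⟨AlgEquiv.ofBijective φ ⟨φ.toRingHom.injective, fun x => ?_⟩⟩
    have hanti : x + i * x * i = 0 := by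
      by_contra h
      refine h2 ⟨_, h, ?_⟩
      simp only [mul_add, add_mul, ← mul_assoc, hi]
      simp only [mul_assoc, hi]
      simp
    have hcomm : i * x = x * i := by
      have := congrArg (fun t => t * i) hanti
      simp only [add_mul, mul_assoc, hi, zero_mul, mul_neg, mul_one] at this
      exact (add_neg_eq_zero.1 this).symm
    obtain ⟨a, b, rfl⟩ := exists_eq_of_commute hi hcomm
    exact ⟨⟨a, b⟩, by simp [φ, Complex.liftAux_apply, Algebra.algebraMap_eq_smul_one]⟩

end Frobenius

/-! ### Splitting `S` into division algebras. -/

section Decomposition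

/-- A finite-dimensional algebra without nonzero nilpotents is a finite product of division
algebras. -/
theorem exists_algEquiv_pi_divisionRing {𝕜 : Type*} [Field 𝕜] {R : Type u} [Ring R] [Algebra 𝕜 R]
    [FiniteDimensional 𝕜 R] (h : ∀ x : R, x * x = 0 → x = 0) :
    ∃ (n : ℕ) (D : Fin n → Type u) (_ : ∀ i, DivisionRing (D i)) (_ : ∀ i, Algebra 𝕜 (D i))
      (_ : ∀ i, FiniteDimensional 𝕜 (D i)), Nonempty (R ≃ₐ[𝕜] Π i, D i) := by
  have : IsArtinianRing R := IsArtinianRing.of_finite 𝕜 R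
  have : IsReduced R := isReduced_iff_pow_one_lt 2 one_lt_two |>.2 fun x hx => h x (by rw [← sq, hx])
  have : IsSemisimpleRing R := by
    rw [IsArtinianRing.isSemisimpleRing_iff_jacobson]
    obtain ⟨n, hn⟩ := IsArtinianRing.isNilpotent_jacobson_bot (R := R)
    refine le_bot_iff.1 fun x hx => ?_
    have hxn : x ^ n ∈ Ring.jacobson R ^ n := Ideal.pow_mem_pow hx n
    rw [← Ideal.jacobson_bot, hn] at hxn
    exact IsReduced.eq_zero x ⟨n, hxn⟩
  obtain ⟨n, D, d, _, _, _, hd, ⟨f⟩⟩ :=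
    IsSemisimpleRing.exists_algEquiv_pi_matrix_divisionRing_finite 𝕜 R
  -- A block of size at least 2 would contain an off-diagonal matrix unit, which squares to zero.
  have hd1 : ∀ i, d i = 1 := by
    intro i
    by_contra hne
    have hpos := Nat.pos_of_ne_zero (hd i).out
    let a : Fin (d i) := ⟨0, by omega⟩
    let b : Fin (d i) := ⟨1, by omega⟩
    have hba : b ≠ a := by simp [a, b]
    have h0 : f.symm (Pi.single i (Matrix.single a b 1)) = 0 := by
      apply h
      rw [← map_mul, ← Pi.single_mul, Matrix.single_mul_single_of_ne _ _ _ _ hba, Pi.single_zero,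
        map_zero]
    rw [map_eq_zero_iff _ f.symm.injective, Pi.single_eq_zero_iff] at h0
    have := congrFun (congrFun h0 a) b
    simp at this
  obtain rfl : d = fun _ => 1 := funext hd1
  have g : ∀ i, Nonempty (Matrix (Fin 1) (Fin 1) (D i) ≃ₐ[𝕜] D i) := fun i => by
    convert Nonempty.intro (Matrix.uniqueAlgEquiv (R := 𝕜) (A := D i) (m := Fin 1))
  exact ⟨n, D, _, _, ‹_›, ⟨f.trans (AlgEquiv.piCongrRight fun i => (g i).some)⟩⟩

variable {𝕜 : Type*} [Field 𝕜] [CharZero 𝕜] {A : Type u} [NonUnitalRing A] [Module 𝕜 A]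
  [IsScalarTower 𝕜 A A] [SMulCommClass 𝕜 A A] [FiniteDimensional 𝕜 A]
  {S : NonUnitalSubalgebra 𝕜 A}

/-- The summands are the images in `A` of the factors of `S ≃ Π i, D i`, and the `e i` are the
images of their identities. -/
theorem exists_isDecomposition (hR : IsAlmostInnerRickart S) (hB : ConditionB S) :
    ∃ (m : ℕ) (e : Fin m → A) (B : Fin m → NonUnitalSubalgebra 𝕜 A), IsDecomposition S e B ∧
      ∀ i, ∃ (D : Type u) (_ : DivisionRing D) (_ : Algebra 𝕜 D),
        FiniteDimensional 𝕜 D ∧ IsCopyOf D (e i) (B i) := by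
  obtain ⟨u, hu⟩ := exists_unit hR hB
  let _ : Ring S :=
    { (inferInstance : NonUnitalRing S) with
      one := u
      one_mul := fun s => (hu s).1
      mul_one := fun s => (hu s).2 }
  let _ : Algebra 𝕜 S := Algebra.ofModule smul_mul_assoc mul_smul_comm
  have hfin : FiniteDimensional 𝕜 S := inferInstanceAs (FiniteDimensional 𝕜 S.toSubmodule)
  obtain ⟨n, D, _, _, _, ⟨f⟩⟩ := exists_algEquiv_pi_divisionRing (𝕜 := 𝕜) (R := S)
    fun x hx => eq_zero_of_mul_self_eq_zero hR hB hx
  let g : (Π i, D i) →ₙₐ[𝕜] A :=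
    (NonUnitalSubalgebraClass.subtype S).comp (f.symm : (Π i, D i) →ₐ[𝕜] S).toNonUnitalAlgHom
  have hg : Function.Injective g := Subtype.val_injective.comp f.symm.injective
  have hgS : LinearMap.range (g : (Π i, D i) →ₗ[𝕜] A) = S.toSubmodule := by
    ext a
    constructor
    · rintro ⟨x, rfl⟩
      exact (f.symm x).2
    · intro ha
      exact ⟨f ⟨a, ha⟩, congrArg Subtype.val (f.symm_apply_apply ⟨a, ha⟩)⟩
  let s : ∀ i, D i →ₙₐ[𝕜] Π i, D i := fun i =>
    { toFun := Pi.single i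
      map_smul' := fun r x => Pi.single_smul i r x
      map_zero' := Pi.single_zero i
      map_add' := Pi.single_add i
      map_mul' := Pi.single_mul i }
  let φ : ∀ i, D i →ₙₐ[𝕜] A := fun i => g.comp (s i)
  have hφ : ∀ i, Function.Injective (φ i) := fun i => hg.comp (Pi.single_injective i)
  have hrange : ∀ i, (NonUnitalAlgHom.range (φ i)).toSubmodule =
      (LinearMap.range (LinearMap.single 𝕜 D i)).map (g : (Π i, D i) →ₗ[𝕜] A) := by
    intro i
    ext a
    simp [φ, s]
  have hsup : ⨆ i, (NonUnitalAlgHom.range (φ i)).toSubmodule = S.toSubmodule := by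
    simp_rw [hrange, ← Submodule.map_iSup, LinearMap.iSup_range_single, Submodule.map_top, hgS]
  refine ⟨n, fun i => φ i 1, fun i => NonUnitalAlgHom.range (φ i), ⟨?_, ?_, ?_, hsup, ?_⟩,
    fun i => ⟨D i, _, _, ‹∀ i, FiniteDimensional 𝕜 (D i)› i, φ i, hφ i, rfl, rfl⟩⟩
  · intro i
    rw [IsIdempotentElem, ← map_mul, one_mul]
  · intro i j hij
    change g (Pi.single i 1) * g (Pi.single j 1) = 0
    rw [← map_mul, ← map_zero g]
    congr 1
    ext k
    rcases eq_or_ne k i with rfl | hk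
    · simp [hij]
    · simp [hk]
  · simp_rw [hrange]
    refine LinearMap.iSupIndep_map _ hg fun i => ?_
    simpa using LinearMap.disjoint_single_single 𝕜 D {i} {i}ᶜ disjoint_compl_right
  · rw [hsup]
    exact hR.isCompl

omit [CharZero 𝕜] [IsScalarTower 𝕜 A A] [SMulCommClass 𝕜 A A] [FiniteDimensional 𝕜 A] in
theorem IsCopyOf.of_algEquiv {D F : Type*} [Ring D] [Algebra 𝕜 D] [Ring F] [Algebra 𝕜 F] {e : A}
    {B : NonUnitalSubalgebra 𝕜 A} (h : IsCopyOf D e B) (f : F ≃ₐ[𝕜] D) : IsCopyOf F e B := by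
  obtain ⟨φ, hφ, rfl, rfl⟩ := h
  refine ⟨φ.comp (f : F →ₐ[𝕜] D).toNonUnitalAlgHom, hφ.comp f.injective, congrArg φ (map_one f), ?_⟩
  ext a
  exact (f.surjective.exists (p := fun x => φ x = a)).symm

end Decomposition

end AlmostRickart

theorem mainTheorem3 :
    (∀ (A : Type u) [NonUnitalRing A] [Module ℝ A] [IsScalarTower ℝ A A] [SMulCommClass ℝ A A]
        [FiniteDimensional ℝ A] (S : NonUnitalSubalgebra ℝ A),
        AlmostRickart.IsAlmostInnerRickart S → AlmostRickart.ConditionB S →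
        (∃ (m : ℕ) (e : Fin m → A) (D : Fin m → NonUnitalSubalgebra ℝ A),
          AlmostRickart.IsDecomposition S e D ∧
          ∀ i, AlmostRickart.IsCopyOf ℝ (e i) (D i) ∨ AlmostRickart.IsCopyOf ℂ (e i) (D i) ∨
            AlmostRickart.IsCopyOf (Quaternion ℝ) (e i) (D i)) ∧
        AlmostRickart.NoMatrixBlocks.{v} S) ∧
    (∀ (A : Type u) [NonUnitalRing A] [Module ℂ A] [IsScalarTower ℂ A A] [SMulCommClass ℂ A A]
        [FiniteDimensional ℂ A] (S : NonUnitalSubalgebra ℂ A),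
        AlmostRickart.IsAlmostInnerRickart S → AlmostRickart.ConditionB S →
        (∃ (m : ℕ) (e : Fin m → A) (D : Fin m → NonUnitalSubalgebra ℂ A),
          AlmostRickart.IsDecomposition S e D ∧
          ∀ i, AlmostRickart.IsCopyOf ℂ (e i) (D i)) ∧
        AlmostRickart.NoMatrixBlocks.{v} S) := by
  constructor
  · intro A _ _ _ _ _ S hR hB
    refine ⟨?_, AlmostRickart.noMatrixBlocks_of_reduced fun x hx =>
      AlmostRickart.eq_zero_of_mul_self_eq_zero hR hB hx⟩
    obtain ⟨m, e, B, hdec, hB⟩ := AlmostRickart.exists_isDecomposition hR hB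
    refine ⟨m, e, B, hdec, fun i => ?_⟩
    obtain ⟨D, _, _, _, hD⟩ := hB i
    exact (AlmostRickart.frobenius_real D).imp (fun ⟨f⟩ => hD.of_algEquiv f)
      (Or.imp (fun ⟨f⟩ => hD.of_algEquiv f) (fun ⟨f⟩ => hD.of_algEquiv f))
  · intro A _ _ _ _ _ S hR hB
    refine ⟨?_, AlmostRickart.noMatrixBlocks_of_reduced fun x hx =>
      AlmostRickart.eq_zero_of_mul_self_eq_zero hR hB hx⟩
    obtain ⟨m, e, B, hdec, hB⟩ := AlmostRickart.exists_isDecomposition hR hB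
    refine ⟨m, e, B, hdec, fun i => ?_⟩
    obtain ⟨D, _, _, _, hD⟩ := hB i
    -- A finite-dimensional division algebra over an algebraically closed field is the field itself.
    exact hD.of_algEquiv (AlgEquiv.ofBijective (Algebra.ofId ℂ D)
      IsAlgClosed.algebraMap_bijective_of_isIntegral)
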